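/- Conventions. A \emph{dagger 2-category} $\mathcal C$ is a 2-category (possibly weak) in which every Hom-category $\mathcal C(r,s)$ carries an involutive, contravariant, identity-on-objects functor $\dagger$, such that $(\alpha\otimes\beta)^\dagger=\alpha^\dagger\otimes\beta^\dagger$ for horizontal composites, and such that the associators and unitors are unitary (automatic in the strict case). 1-morphisms are composed from left to right: for $X:r\to s$ and $Y:s\to t$ the composite is $X\otimes Y:r\to t$. A 2-morphism $\alpha:X\to Y$ is an \emph{isometry} if $\alpha^\dagger\circ\alpha=\mathrm{id}_X$, and \emph{unitary} if moreover $\alpha\circ\alpha^\dagger=\mathrm{id}_Y$. \emph{Dagger idempotents split} in $\mathcal C$ if for every 2-morphism $p:X\to X$ with $p=p^\dagger=p\circ p$ there is an isometry $\iota:V\to X$ with $\iota\circ\iota^\dagger=p$. Objects $s,t$ are \emph{dagger equivalent} if there are 1-morphisms $E:s\to t$, $E':t\to s$ and unitary 2-morphisms $\mathrm{id}_t\to E'\otimes E$ and $E\otimes E'\to\mathrm{id}_s$. A \emph{special right dual} of $X:r\to s$ is a triple $[X^*,\eta,\epsilon]$ with $X^*:s\to r$, $\eta:\mathrm{id}_s\to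 X^*\otimes X$ and $\epsilon:X\otimes X^*\to\mathrm{id}_r$ satisfying the snake equations and $\eta^\dagger\circ\eta=\mathrm{id}_{\mathrm{id}_s}$; $X$ is \emph{special} if it has one. A \emph{special Frobenius monoid} in a monoidal dagger category is a monoid $(A,m,u)$ with $(m\otimes \mathrm{id}_A)\circ(\mathrm{id}_A\otimes m^\dagger)=m^\dagger\circ m=(\mathrm{id}_A\otimes m)\circ(m^\dagger\otimes \mathrm{id}_A)$ and $m\circ m^\dagger=\mathrm{id}_A$. A special right dual of $X$ makes $X\otimes X^*$ a special Frobenius monoid in the monoidal dagger category $\mathrm{End}(r)=\mathcal C(r,r)$, with multiplication $\mathrm{id}_X\otimes\eta^\dagger\otimes\mathrm{id}_{X^*}$ and unit $\epsilon^\dagger$. For special Frobenius monoids $A,B$, an $A$-$B$ \emph{dagger bimodule} is an object $M$ with a morphism $\rho:A\otimes M\otimes B\to M$ such that (coherence isomorphisms suppressed) $\rho\circ(m_A\otimes\mathrm{id}_M\otimes m_B)=\rho\circ(\mathrm{id}_A\otimes\rho\otimes\mathrm{id}_B)$, $\rho\circ(u_A\otimes\mathrm{id}_M\otimes u_B)=\mathrm{id}_M$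 and $(u_A^\dagger m_A\otimes\mathrm{id}_M\otimes u_B^\dagger m_B)\circ(\mathrm{id}_A\otimes\rho^\dagger\otimes\mathrm{id}_B)=\rho$. Two $A$-$B$ dagger bimodules are isomorphic if there is a unitary morphism between them that commutes with the actions. The trivial bimodule ${}_AA_A$ is $A$ with the action by multiplication. Write $\lambda_M=\rho\circ(\mathrm{id}_{A\otimes M}\otimes u_B)$ and $\mu_M=\rho\circ(u_A\otimes\mathrm{id}_{M\otimes B})$ for the one-sided actions. The \emph{relative tensor product} ${}_AM\otimes_BN_D$ of dagger bimodules ${}_AM_B$ and ${}_BN_D$ is given by an isometry $i:M\otimes_BN\to M\otimes N$ with $i\circ i^\dagger=(\mu_M\otimes\lambda_N)\circ(\mathrm{id}_M\otimes (m_B^\dagger\circ u_B)\otimes\mathrm{id}_N)$, with the action $i^\dagger\circ(\lambda_M\otimes\mu_N)\circ(\mathrm{id}_A\otimes i\otimes\mathrm{id}_D)$. Special Frobenius monoids $A,B$ are \emph{Morita equivalent} if there are dagger bimodules ${}_AM_B$ and ${}_BN_A$ with ${}_AM\otimes_BN_A\cong{}_AA_A$ and ${}_BN\otimes_AM_B\cong{}_BB_B$.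 \textbf{Theorem.} Let $\mathcal C$ be a dagger 2-category in which all dagger idempotents split, and let $X:r\to s$ and $Y:r\to t$ be special 1-morphisms, with any choice of special right duals $X^*$ and $Y^*$. Then the special Frobenius monoids $X\otimes X^*$ and $Y\otimes Y^*$ in $\mathrm{End}(r)$ are Morita equivalent if and only if $s$ and $t$ are dagger equivalent. -/

import Mathlib

open CategoryTheory

universe w v u v₁ u₁

namespace DaggerTwoCat

section DaggerCategories

open MonoidalCategory

/-- A dagger category: a category with an involutive contravariant endofunctor that is the identity
on objects. -/
class DaggerCategory (C : Type u₁) [Category.{v₁} C] where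
  /-- The dagger of a morphism. -/
  dagger {X Y : C} (f : X ⟶ Y) : Y ⟶ X
  dagger_id (X : C) : dagger (𝟙 X) = 𝟙 X
  dagger_comp {X Y Z : C} (f : X ⟶ Y) (g : Y ⟶ Z) : dagger (f ≫ g) = dagger g ≫ dagger f
  dagger_dagger {X Y : C} (f : X ⟶ Y) : dagger (dagger f) = f

open DaggerCategory

/-- `f` is an isometry: `f† ∘ f = id`. -/
def IsIsometry {C : Type u₁} [Category.{v₁} C] [DaggerCategory C] {X Y : C} (f : X ⟶ Y) : Prop :=
  f ≫ dagger f = 𝟙 X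

/-- `f` is unitary: `f† ∘ f = id` and `f ∘ f† = id`. -/
def IsUnitary {C : Type u₁} [Category.{v₁} C] [DaggerCategory C] {X Y : C} (f : X ⟶ Y) : Prop :=
  f ≫ dagger f = 𝟙 X ∧ dagger f ≫ f = 𝟙 Y

/-- `p` is a dagger idempotent: `p = p† = p ∘ p`. -/
def IsDaggerIdempotent {C : Type u₁} [Category.{v₁} C] [DaggerCategory C] {X : C} (p : X ⟶ X) :
    Prop :=
  dagger p = p ∧ p ≫ p = p

/-- The isometry `i : V ⟶ X` splits the endomorphism `p` of `X`: `i ∘ i† = p`. -/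
def Splits {C : Type u₁} [Category.{v₁} C] [DaggerCategory C] {V X : C} (i : V ⟶ X) (p : X ⟶ X) :
    Prop :=
  IsIsometry i ∧ dagger i ≫ i = p

/-- A monoidal dagger category: the dagger respects the tensor product, and the associators and
unitors (which are identities in the strict case) are unitary. -/
class MonoidalDaggerCategory (C : Type u₁) [Category.{v₁} C] [MonoidalCategory C]
    [DaggerCategory C] : Prop where
  dagger_tensorHom {X X' Y Y' : C} (f : X ⟶ X') (g : Y ⟶ Y') :
    dagger (f ⊗ₘ g) = dagger f ⊗ₘ dagger g
  dagger_associator (X Y Z : C) : dagger (α_ X Y Z).hom = (α_ X Y Z).inv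
  dagger_leftUnitor (X : C) : dagger (λ_ X).hom = (λ_ X).inv
  dagger_rightUnitor (X : C) : dagger (ρ_ X).hom = (ρ_ X).inv

open MonoidalDaggerCategory

section Lemmas

variable {C : Type u₁} [Category.{v₁} C] [MonoidalCategory C] [DaggerCategory C]
  [MonoidalDaggerCategory C]

theorem dagger_whiskerLeft (X : C) {Y Z : C} (f : Y ⟶ Z) : dagger (X ◁ f) = X ◁ dagger f := by
  rw [← id_tensorHom, dagger_tensorHom, dagger_id, id_tensorHom]

theorem dagger_whiskerRight {Y Z : C} (f : Y ⟶ Z) (X : C) : dagger (f ▷ X) = dagger f ▷ X := by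
  rw [← tensorHom_id, dagger_tensorHom, dagger_id, tensorHom_id]

end Lemmas

/-- A special Frobenius monoid in a monoidal dagger category: a monoid `(X, m, u)` such that `m`
and its dagger `m†` satisfy the Frobenius equations, and `m ∘ m† = id`. -/
structure SpecialFrobeniusMonoid (C : Type u₁) [Category.{v₁} C] [MonoidalCategory C]
    [DaggerCategory C] where
  /-- The underlying object. -/
  X : C
  /-- The monoid structure. -/
  [mon : MonObj X]
  frobenius_left :
    X ◁ dagger (MonObj.mul (X := X)) ≫ (α_ X X X).inv ≫ MonObj.mul (X := X) ▷ X =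
      MonObj.mul (X := X) ≫ dagger (MonObj.mul (X := X))
  frobenius_right :
    dagger (MonObj.mul (X := X)) ▷ X ≫ (α_ X X X).hom ≫ X ◁ MonObj.mul (X := X) =
      MonObj.mul (X := X) ≫ dagger (MonObj.mul (X := X))
  special : dagger (MonObj.mul (X := X)) ≫ MonObj.mul (X := X) = 𝟙 X

namespace SpecialFrobeniusMonoid

variable {C : Type u₁} [Category.{v₁} C] [MonoidalCategory C] [DaggerCategory C]

/-- The multiplication `m : A ⊗ A ⟶ A`. -/
def m (A : SpecialFrobeniusMonoid C) : A.X ⊗ A.X ⟶ A.X := A.mon.mul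

/-- The unit `u : 𝟙_ C ⟶ A`. -/
def u (A : SpecialFrobeniusMonoid C) : 𝟙_ C ⟶ A.X := A.mon.one

theorem u_m (A : SpecialFrobeniusMonoid C) : A.u ▷ A.X ≫ A.m = (λ_ A.X).hom :=
  A.mon.one_mul

theorem m_u (A : SpecialFrobeniusMonoid C) : A.X ◁ A.u ≫ A.m = (ρ_ A.X).hom :=
  A.mon.mul_one

theorem m_assoc (A : SpecialFrobeniusMonoid C) :
    A.m ▷ A.X ≫ A.m = (α_ A.X A.X A.X).hom ≫ A.X ◁ A.m ≫ A.m :=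
  A.mon.mul_assoc

/-- The cup `m† ∘ u : 𝟙_ C ⟶ A ⊗ A`. -/
def cup (A : SpecialFrobeniusMonoid C) : 𝟙_ C ⟶ A.X ⊗ A.X := A.u ≫ dagger A.m

/-- The cap `u† ∘ m : A ⊗ A ⟶ 𝟙_ C`. -/
def cap (A : SpecialFrobeniusMonoid C) : A.X ⊗ A.X ⟶ 𝟙_ C := A.m ≫ dagger A.u

end SpecialFrobeniusMonoid

/-- The rebracketing `(A ⊗ A) ⊗ (M ⊗ (B ⊗ B)) ≅ A ⊗ ((A ⊗ (M ⊗ B)) ⊗ B)`. -/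
def rebracket {C : Type u₁} [Category.{v₁} C] [MonoidalCategory C] (A M B : C) :
    (A ⊗ A) ⊗ (M ⊗ (B ⊗ B)) ≅ A ⊗ ((A ⊗ (M ⊗ B)) ⊗ B) where
  hom := (α_ A A (M ⊗ (B ⊗ B))).hom ≫ A ◁ (A ◁ (α_ M B B).inv ≫ (α_ A (M ⊗ B) B).inv)
  inv := A ◁ ((α_ A (M ⊗ B) B).hom ≫ A ◁ (α_ M B B).hom) ≫ (α_ A A (M ⊗ (B ⊗ B))).inv

/-- A dagger bimodule between special Frobenius monoids. -/
structure DaggerBimodule {C : Type u₁} [Category.{v₁} C] [MonoidalCategory C] [DaggerCategory C]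
    (A B : SpecialFrobeniusMonoid C) where
  /-- The underlying object. -/
  X : C
  /-- The action `A ⊗ M ⊗ B ⟶ M`. -/
  act : A.X ⊗ (X ⊗ B.X) ⟶ X
  act_mul : (A.m ⊗ₘ (X ◁ B.m)) ≫ act = (rebracket A.X X B.X).hom ≫ A.X ◁ (act ▷ B.X) ≫ act
  act_unit : (A.u ⊗ₘ (X ◁ B.u)) ≫ act = (λ_ _).hom ≫ (ρ_ X).hom
  act_dagger : A.X ◁ (dagger act ▷ B.X) ≫ (rebracket A.X X B.X).inv ≫
    (A.cap ⊗ₘ (X ◁ B.cap)) ≫ (λ_ _).hom ≫ (ρ_ X).hom = act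

namespace DaggerBimodule

variable {C : Type u₁} [Category.{v₁} C] [MonoidalCategory C] [DaggerCategory C]
  {A B D : SpecialFrobeniusMonoid C}

/-- The action of `A` alone, obtained by inserting the unit of `B`. -/
def actLeft (M : DaggerBimodule A B) : A.X ⊗ M.X ⟶ M.X :=
  A.X ◁ ((ρ_ M.X).inv ≫ M.X ◁ B.u) ≫ M.act

/-- The action of `B` alone, obtained by inserting the unit of `A`. -/
def actRight (M : DaggerBimodule A B) : M.X ⊗ B.X ⟶ M.X :=
  (λ_ _).inv ≫ A.u ▷ (M.X ⊗ B.X) ≫ M.act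

/-- Isomorphism of dagger bimodules: there is a unitary morphism which commutes with the
actions. -/
def Isomorphic (M N : DaggerBimodule A B) : Prop :=
  ∃ f : M.X ⟶ N.X, IsUnitary f ∧ A.X ◁ (f ▷ B.X) ≫ N.act = M.act ≫ f

/-- The endomorphism of `M ⊗ N` whose image is the relative tensor product: create a pair of
`B`-wires by the cup between `M` and `N`, and let them act on `M` and `N`. -/
def relIdem (M : DaggerBimodule A B) (N : DaggerBimodule B D) : M.X ⊗ N.X ⟶ M.X ⊗ N.X :=
  M.X ◁ ((λ_ N.X).inv ≫ B.cup ▷ N.X ≫ (α_ B.X B.X N.X).hom) ≫ (α_ M.X B.X (B.X ⊗ N.X)).inv ≫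
    (M.actRight ⊗ₘ N.actLeft)

/-- The dagger bimodule `T`, together with `i : T ⟶ M ⊗ N`, is the relative tensor product
`M ⊗_B N`: the isometry `i` splits the idempotent `relIdem M N`, and the action on `T` is
`A ⊗ T ⊗ D ⟶ A ⊗ M ⊗ N ⊗ D ⟶ M ⊗ N ⟶ T`, given by `i`, the actions of `A` on `M` and of `D`
on `N`, and `i†`. -/
structure IsRelativeTensorProduct (M : DaggerBimodule A B) (N : DaggerBimodule B D)
    (T : DaggerBimodule A D) (i : T.X ⟶ M.X ⊗ N.X) : Prop where
  splits : Splits i (relIdem M N)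
  act_eq : T.act = A.X ◁ (i ▷ D.X ≫ (α_ M.X N.X D.X).hom) ≫ (α_ A.X M.X (N.X ⊗ D.X)).inv ≫
    (M.actLeft ⊗ₘ N.actRight) ≫ dagger i

end DaggerBimodule

section Trivial

variable {C : Type u₁} [Category.{v₁} C] [MonoidalCategory C] [DaggerCategory C]
  [MonoidalDaggerCategory C]

namespace SpecialFrobeniusMonoid

theorem cap_left (A : SpecialFrobeniusMonoid C) :
    A.X ◁ dagger A.m ≫ (α_ A.X A.X A.X).inv ≫ A.cap ▷ A.X ≫ (λ_ A.X).hom = A.m := by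
  have h : A.X ◁ dagger A.m ≫ (α_ A.X A.X A.X).inv ≫ A.m ▷ A.X = A.m ≫ dagger A.m :=
    A.frobenius_left
  have h₂ : dagger A.m ≫ dagger A.u ▷ A.X = (λ_ A.X).inv := by
    rw [← dagger_whiskerRight, ← dagger_comp, A.u_m, dagger_leftUnitor]
  calc _ = (A.X ◁ dagger A.m ≫ (α_ A.X A.X A.X).inv ≫ A.m ▷ A.X) ≫
        dagger A.u ▷ A.X ≫ (λ_ A.X).hom := by
        simp [cap]
    _ = _ := by rw [h, Category.assoc, reassoc_of% h₂]; simp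

theorem cap_right (A : SpecialFrobeniusMonoid C) :
    dagger A.m ▷ A.X ≫ (α_ A.X A.X A.X).hom ≫ A.X ◁ A.cap ≫ (ρ_ A.X).hom = A.m := by
  have h : dagger A.m ▷ A.X ≫ (α_ A.X A.X A.X).hom ≫ A.X ◁ A.m = A.m ≫ dagger A.m :=
    A.frobenius_right
  have h₂ : dagger A.m ≫ A.X ◁ dagger A.u = (ρ_ A.X).inv := by
    rw [← dagger_whiskerLeft, ← dagger_comp, A.m_u, dagger_rightUnitor]
  calc _ = (dagger A.m ▷ A.X ≫ (α_ A.X A.X A.X).hom ≫ A.X ◁ A.m) ≫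
        A.X ◁ dagger A.u ≫ (ρ_ A.X).hom := by
        simp [cap]
    _ = _ := by rw [h, Category.assoc, reassoc_of% h₂]; simp

/-- The trivial dagger bimodule `A` over `A` and `A`, with action by multiplication. -/
abbrev trivialBimodule (A : SpecialFrobeniusMonoid C) : DaggerBimodule A A where
  X := A.X
  act := A.X ◁ A.m ≫ A.m
  act_mul := by
    have h := A.m_assoc
    calc (A.m ⊗ₘ (A.X ◁ A.m)) ≫ A.X ◁ A.m ≫ A.m
        = (A.X ⊗ A.X) ◁ (A.X ◁ A.m ≫ A.m) ≫ A.m ▷ A.X ≫ A.m := by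
          rw [MonoidalCategory.tensorHom_def', Category.assoc,
            ← MonoidalCategory.whisker_exchange_assoc, MonoidalCategory.whiskerLeft_comp,
            Category.assoc]
      _ = (rebracket A.X A.X A.X).hom ≫
            A.X ◁ ((A.X ◁ A.m) ▷ A.X ≫ A.m ▷ A.X ≫ A.m) ≫ A.m := by
          have h₂ : (A.X ◁ A.m) ▷ A.X ≫ (α_ A.X A.X A.X).hom ≫ A.X ◁ A.m ≫ A.m =
            (α_ A.X (A.X ⊗ A.X) A.X).hom ≫ A.X ◁ (A.m ▷ A.X ≫ A.m) ≫ A.m := by simp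
          rw [h, h₂, h]
          simp [rebracket]
      _ = _ := by simp
  act_unit := by
    calc (A.u ⊗ₘ (A.X ◁ A.u)) ≫ A.X ◁ A.m ≫ A.m
        = 𝟙_ C ◁ (A.X ◁ A.u ≫ A.m) ≫ A.u ▷ A.X ≫ A.m := by
          rw [MonoidalCategory.tensorHom_def', Category.assoc,
            ← MonoidalCategory.whisker_exchange_assoc, MonoidalCategory.whiskerLeft_comp,
            Category.assoc]
      _ = _ := by rw [A.m_u, A.u_m]; monoidal
  act_dagger := by
    have h : dagger A.m ▷ A.X ≫ (α_ A.X A.X A.X).hom ≫ A.X ◁ A.m = A.m ≫ dagger A.m :=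
      A.frobenius_right
    have key : A.X ◁ ((dagger A.m ≫ A.X ◁ dagger A.m) ▷ A.X) ≫ (rebracket A.X A.X A.X).inv ≫
        (A.cap ⊗ₘ (A.X ◁ A.cap)) ≫ (λ_ _).hom ≫ (ρ_ A.X).hom =
        A.X ◁ (dagger A.m ▷ A.X ≫ (α_ _ _ _).hom ≫
          A.X ◁ (dagger A.m ▷ A.X ≫ (α_ A.X A.X A.X).hom ≫ A.X ◁ A.cap ≫ (ρ_ A.X).hom)) ≫
        (α_ _ _ _).inv ≫ A.cap ▷ A.X ≫ (λ_ A.X).hom := by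
      rw [MonoidalCategory.tensorHom_def']
      dsimp [rebracket]
      monoidal
    rw [dagger_comp, dagger_whiskerLeft, key, A.cap_right, h, whiskerLeft_comp, Category.assoc,
      A.cap_left]

end SpecialFrobeniusMonoid

/-- Morita equivalence of special Frobenius monoids: there are dagger bimodules `M` and `N` with
`M ⊗_B N ≅ A` and `N ⊗_A M ≅ B` as dagger bimodules. -/
def MoritaEquivalent (A B : SpecialFrobeniusMonoid C) : Prop :=
  ∃ (M : DaggerBimodule A B) (N : DaggerBimodule B A),
    (∃ (T : DaggerBimodule A A) (i : T.X ⟶ M.X ⊗ N.X),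
      DaggerBimodule.IsRelativeTensorProduct M N T i ∧ T.Isomorphic A.trivialBimodule) ∧
    (∃ (T : DaggerBimodule B B) (i : T.X ⟶ N.X ⊗ M.X),
      DaggerBimodule.IsRelativeTensorProduct N M T i ∧ T.Isomorphic B.trivialBimodule)

end Trivial

end DaggerCategories

section DaggerTwoCategories

open Bicategory DaggerCategory

/-- A dagger 2-category: a (possibly weak) 2-category whose Hom-categories are dagger categories,
such that the dagger respects the composition of 1-morphisms, and the associators and unitors (which
are identities in the strict case) are unitary. -/
class DaggerBicategory (B : Type u) [Bicategory.{w, v} B] where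
  /-- The dagger on the Hom-categories. -/
  homDagger (r s : B) : DaggerCategory (r ⟶ s)
  dagger_hcomp {r s t : B} {X X' : r ⟶ s} {Y Y' : s ⟶ t} (f : X ⟶ X') (g : Y ⟶ Y') :
    dagger (f ▷ Y ≫ X' ◁ g) = dagger f ▷ Y' ≫ X ◁ dagger g
  dagger_associator {r s t q : B} (X : r ⟶ s) (Y : s ⟶ t) (Z : t ⟶ q) :
    dagger (α_ X Y Z).hom = (α_ X Y Z).inv
  dagger_leftUnitor {r s : B} (X : r ⟶ s) : dagger (λ_ X).hom = (λ_ X).inv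
  dagger_rightUnitor {r s : B} (X : r ⟶ s) : dagger (ρ_ X).hom = (ρ_ X).inv

variable {B : Type u} [Bicategory.{w, v} B] [DaggerBicategory B]

instance (r s : B) : DaggerCategory (r ⟶ s) := DaggerBicategory.homDagger r s

/-- `End(r)` is a monoidal dagger category. -/
instance (r : B) : MonoidalDaggerCategory (r ⟶ r) where
  dagger_tensorHom f g := DaggerBicategory.dagger_hcomp f g
  dagger_associator := DaggerBicategory.dagger_associator
  dagger_leftUnitor := DaggerBicategory.dagger_leftUnitor
  dagger_rightUnitor := DaggerBicategory.dagger_rightUnitor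

/-- All dagger idempotents split. -/
def SplitDaggerIdempotents (B : Type u) [Bicategory.{w, v} B] [DaggerBicategory B] : Prop :=
  ∀ (r s : B) (X : r ⟶ s) (p : X ⟶ X), IsDaggerIdempotent p → ∃ (V : r ⟶ s) (i : V ⟶ X), Splits i p

/-- The 1-morphism `E : s ⟶ t` is a dagger equivalence. -/
def IsDaggerEquivalence {s t : B} (E : s ⟶ t) : Prop :=
  ∃ (E' : t ⟶ s) (unit : 𝟙 t ⟶ E' ≫ E) (counit : E ≫ E' ⟶ 𝟙 s),
    IsUnitary unit ∧ IsUnitary counit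

/-- The objects `s` and `t` are dagger equivalent. -/
def DaggerEquivalent (s t : B) : Prop := ∃ E : s ⟶ t, IsDaggerEquivalence E

/-- A special right dual of `X : r ⟶ s`: a 1-morphism `X* : s ⟶ r` with `η : 𝟙 s ⟶ X* ≫ X` and
`ε : X ≫ X* ⟶ 𝟙 r` which satisfy the snake equations (that is, an adjunction `X* ⊣ X`), such that
`η† ∘ η = id`. The 1-morphism `X` is special if it has a special right dual. -/
structure SpecialRightDual {r s : B} (X : r ⟶ s) where
  /-- The dual 1-morphism `X*`. -/
  dual : s ⟶ r
  /-- The cup, the cap and the snake equations. -/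
  adj : dual ⊣ X
  special : IsIsometry adj.unit

theorem dagger_whiskerLeft₂ {r s t : B} (X : r ⟶ s) {Y Z : s ⟶ t} (f : Y ⟶ Z) :
    dagger (X ◁ f) = X ◁ dagger f := by
  have h := DaggerBicategory.dagger_hcomp (𝟙 X) f
  simpa [dagger_id] using h

theorem dagger_whiskerRight₂ {r s t : B} {X Y : r ⟶ s} (f : X ⟶ Y) (Z : s ⟶ t) :
    dagger (f ▷ Z) = dagger f ▷ Z := by
  have h := DaggerBicategory.dagger_hcomp f (𝟙 Z)
  simpa [dagger_id] using h

theorem dagger_associator_inv {r s t q : B} (X : r ⟶ s) (Y : s ⟶ t) (Z : t ⟶ q) :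
    dagger (α_ X Y Z).inv = (α_ X Y Z).hom := by
  rw [← DaggerBicategory.dagger_associator, dagger_dagger]

theorem dagger_leftUnitor_inv {r s : B} (X : r ⟶ s) : dagger (λ_ X).inv = (λ_ X).hom := by
  rw [← DaggerBicategory.dagger_leftUnitor, dagger_dagger]

theorem dagger_rightUnitor_inv {r s : B} (X : r ⟶ s) : dagger (ρ_ X).inv = (ρ_ X).hom := by
  rw [← DaggerBicategory.dagger_rightUnitor, dagger_dagger]

namespace SpecialRightDual

variable {r s : B} {X : r ⟶ s}

/-- The multiplication `X ⊗ η† ⊗ X*` on `X ⊗ X*`. -/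
def mul (d : SpecialRightDual X) : (X ≫ d.dual) ≫ (X ≫ d.dual) ⟶ X ≫ d.dual :=
  (α_ X d.dual (X ≫ d.dual)).hom ≫
    X ◁ ((α_ d.dual X d.dual).inv ≫ dagger d.adj.unit ▷ d.dual ≫ (λ_ d.dual).hom)

theorem dagger_mul (d : SpecialRightDual X) : dagger d.mul =
    X ◁ ((λ_ d.dual).inv ≫ d.adj.unit ▷ d.dual ≫ (α_ d.dual X d.dual).hom) ≫
      (α_ X d.dual (X ≫ d.dual)).inv := by
  simp only [mul, dagger_comp, dagger_whiskerLeft₂, dagger_whiskerRight₂, dagger_dagger,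
    dagger_associator_inv, DaggerBicategory.dagger_associator, DaggerBicategory.dagger_leftUnitor,
    Category.assoc]

theorem snake_left (d : SpecialRightDual X) :
    dagger d.adj.counit ▷ X ≫ (α_ X d.dual X).hom ≫ X ◁ dagger d.adj.unit =
      (λ_ X).hom ≫ (ρ_ X).inv := by
  have h := congrArg dagger d.adj.right_triangle
  simpa [rightZigzag, bicategoricalComp, dagger_comp, dagger_whiskerLeft₂, dagger_whiskerRight₂,
    dagger_associator_inv, dagger_leftUnitor_inv, DaggerBicategory.dagger_rightUnitor] using h

theorem snake_right (d : SpecialRightDual X) :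
    d.dual ◁ dagger d.adj.counit ≫ (α_ d.dual X d.dual).inv ≫ dagger d.adj.unit ▷ d.dual =
      (ρ_ d.dual).hom ≫ (λ_ d.dual).inv := by
  have h := congrArg dagger d.adj.left_triangle
  simpa [leftZigzag, bicategoricalComp, dagger_comp, dagger_whiskerLeft₂, dagger_whiskerRight₂,
    DaggerBicategory.dagger_associator, dagger_rightUnitor_inv,
    DaggerBicategory.dagger_leftUnitor] using h

/-- The monoid structure on `X ⊗ X*`, with multiplication `X ⊗ η† ⊗ X*` and unit `ε†`. -/
abbrev monObj (d : SpecialRightDual X) : MonObj (X ≫ d.dual) where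
  one := dagger d.adj.counit
  mul := d.mul
  one_mul := by
    change dagger d.adj.counit ▷ (X ≫ d.dual) ≫ d.mul = (λ_ (X ≫ d.dual)).hom
    calc _ = 𝟙 _ ⊗≫ (dagger d.adj.counit ▷ X ≫ (α_ X d.dual X).hom ≫
          X ◁ dagger d.adj.unit) ▷ d.dual ⊗≫ 𝟙 _ := by
          dsimp only [mul]; bicategory
      _ = _ := by rw [snake_left]; bicategory
  mul_one := by
    change (X ≫ d.dual) ◁ dagger d.adj.counit ≫ d.mul = (ρ_ (X ≫ d.dual)).hom
    calc _ = 𝟙 _ ⊗≫ X ◁ (d.dual ◁ dagger d.adj.counit ≫ (α_ d.dual X d.dual).inv ≫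
          dagger d.adj.unit ▷ d.dual) ⊗≫ 𝟙 _ := by
          dsimp only [mul]; bicategory
      _ = _ := by rw [snake_right]; bicategory
  mul_assoc := by
    change d.mul ▷ (X ≫ d.dual) ≫ d.mul = (α_ (X ≫ d.dual) (X ≫ d.dual) (X ≫ d.dual)).hom ≫
      (X ≫ d.dual) ◁ d.mul ≫ d.mul
    calc _ = 𝟙 _ ⊗≫ X ◁ (dagger d.adj.unit ▷ (d.dual ≫ X) ≫ 𝟙 s ◁ dagger d.adj.unit) ▷ d.dual
          ⊗≫ 𝟙 _ := by
          dsimp only [mul]; bicategory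
      _ = _ := by rw [← whisker_exchange]; dsimp only [mul]; bicategory

/-- The special Frobenius monoid `X ⊗ X*` in `End(r)`. -/
abbrev frobeniusMonoid (d : SpecialRightDual X) : SpecialFrobeniusMonoid (r ⟶ r) where
  X := X ≫ d.dual
  mon := d.monObj
  frobenius_left := by
    change (X ≫ d.dual) ◁ dagger d.mul ≫ (α_ (X ≫ d.dual) (X ≫ d.dual) (X ≫ d.dual)).inv ≫
      d.mul ▷ (X ≫ d.dual) = d.mul ≫ dagger d.mul
    rw [dagger_mul]
    calc _ = 𝟙 _ ⊗≫ X ◁ ((d.dual ≫ X) ◁ d.adj.unit ≫ dagger d.adj.unit ▷ (d.dual ≫ X)) ▷ d.dual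
          ⊗≫ 𝟙 _ := by
          dsimp only [mul]; bicategory
      _ = _ := by rw [whisker_exchange]; dsimp only [mul]; bicategory
  frobenius_right := by
    change dagger d.mul ▷ (X ≫ d.dual) ≫ (α_ (X ≫ d.dual) (X ≫ d.dual) (X ≫ d.dual)).hom ≫
      (X ≫ d.dual) ◁ d.mul = d.mul ≫ dagger d.mul
    rw [dagger_mul]
    calc _ = 𝟙 _ ⊗≫ X ◁ (d.adj.unit ▷ (d.dual ≫ X) ≫ (d.dual ≫ X) ◁ dagger d.adj.unit) ▷ d.dual
          ⊗≫ 𝟙 _ := by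
          dsimp only [mul]; bicategory
      _ = _ := by rw [← whisker_exchange]; dsimp only [mul]; bicategory
  special := by
    change dagger d.mul ≫ d.mul = 𝟙 (X ≫ d.dual)
    rw [dagger_mul]
    calc _ = 𝟙 _ ⊗≫ X ◁ (d.adj.unit ≫ dagger d.adj.unit) ▷ d.dual ⊗≫ 𝟙 _ := by
          dsimp only [mul]; bicategory
      _ = _ := by rw [show d.adj.unit ≫ dagger d.adj.unit = 𝟙 _ from d.special]; bicategory

end SpecialRightDual

end DaggerTwoCategories

end DaggerTwoCat

namespace DaggerTwoCat

section Monoidal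

open MonoidalCategory DaggerCategory MonoidalDaggerCategory

/-! ### Unitaries in a dagger category. -/

section Unitary

variable {C : Type u₁} [Category.{v₁} C] [DaggerCategory C]

/-! The assignment `F ↦ X ⊗ F ⊗ Y*` embeds `C(s,t)` into the dagger bimodules over `X ⊗ X*` and `Y ⊗
Y*`, and it behaves like an equivalence that turns composition of 1-morphisms into relative tensor
products. Given this, invertibility of a bimodule under relative tensor product, up to unitaries, is
the same as dagger invertibility of the corresponding 1-morphism.

Four facts carry this. Faithfulness (`whiskerLeft_whiskerRight_injective`) and fullness
(`exists_eq_whisker`) hold because `η† ∘ η = id` lets one strip off `X` and `Y*` by adding `X*` and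
`Y` outside and conjugating with the cups `η` and caps `η†`; hence unitary bimodule isomorphisms
correspond to unitary 2-morphisms. Monoidality (`isRelativeTensorProduct_sandwich`) holds because
the snake equations reduce the idempotent defining `(X ⊗ F ⊗ Y*) ⊗ (Y ⊗ G ⊗ Z*)` over `Y ⊗ Y*` to `η
∘ η†` in the middle, which `η` splits. Units match because the trivial bimodule is `X ⊗ id ⊗ X*` up
to a unitor.

Essential surjectivity (`exists_sandwich_isomorphic`) is where splitting is needed: the action makes
any bimodule `M` the image of a dagger idempotent on `X ⊗ (X* ⊗ M ⊗ Y) ⊗ Y*`. By fullness and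
faithfulness this idempotent comes from one on `X* ⊗ M ⊗ Y`, and its splitting gives the 1-morphism
sought. -/

theorem IsUnitary.dagger {X Y : C} {f : X ⟶ Y} (hf : IsUnitary f) : IsUnitary (dagger f) :=
  ⟨by rw [dagger_dagger, hf.2], by rw [dagger_dagger, hf.1]⟩

theorem IsUnitary.comp {X Y Z : C} {f : X ⟶ Y} {g : Y ⟶ Z} (hf : IsUnitary f)
    (hg : IsUnitary g) : IsUnitary (f ≫ g) := by
  constructor
  · rw [dagger_comp, Category.assoc, ← Category.assoc g, hg.1, Category.id_comp, hf.1]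
  · rw [dagger_comp, Category.assoc, ← Category.assoc (DaggerCategory.dagger f), hf.2,
      Category.id_comp, hg.2]

/-- A unitary that intertwines two endomorphisms induces a unitary between their splittings. -/
theorem isUnitary_of_splits {V W X Y : C} {i : V ⟶ X} {j : W ⟶ Y} {p : X ⟶ X} {q : Y ⟶ Y}
    (hi : Splits i p) (hj : Splits j q) {f : X ⟶ Y} (hf : IsUnitary f) (h : p ≫ f = f ≫ q) :
    IsUnitary (i ≫ f ≫ DaggerCategory.dagger j) := by
  obtain ⟨hi₁, rfl⟩ := hi
  obtain ⟨hj₁, rfl⟩ := hj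
  have hi₂ : i ≫ DaggerCategory.dagger i = 𝟙 V := hi₁
  have hj₂ : j ≫ DaggerCategory.dagger j = 𝟙 W := hj₁
  simp only [Category.assoc] at h
  constructor
  · simp only [dagger_comp, dagger_dagger, Category.assoc]
    rw [← reassoc_of% h, reassoc_of% hi₂, ← Category.assoc f, hf.1, Category.id_comp, hi₂]
  · simp only [dagger_comp, dagger_dagger, Category.assoc]
    rw [reassoc_of% h, ← Category.assoc (DaggerCategory.dagger f), hf.2, Category.id_comp,
      reassoc_of% hj₂, hj₂]

end Unitary

variable {C : Type u₁} [Category.{v₁} C] [MonoidalCategory C] [DaggerCategory C]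

theorem IsUnitary.tensorHom [MonoidalDaggerCategory C] {X Y X' Y' : C} {f : X ⟶ Y} {g : X' ⟶ Y'}
    (hf : IsUnitary f) (hg : IsUnitary g) : IsUnitary (f ⊗ₘ g) := by
  constructor
  · rw [dagger_tensorHom, tensorHom_comp_tensorHom, hf.1, hg.1, id_tensorHom_id]
  · rw [dagger_tensorHom, tensorHom_comp_tensorHom, hf.2, hg.2, id_tensorHom_id]

/-! ### Bimodule morphisms and invariance of the relative tensor product. -/

namespace DaggerBimodule

variable {A B D : SpecialFrobeniusMonoid C}

theorem Isomorphic.symm {M N : DaggerBimodule A B} (h : M.Isomorphic N) : N.Isomorphic M := by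
  obtain ⟨f, hf, hfa⟩ := h
  refine ⟨dagger f, hf.dagger, ?_⟩
  calc _ = A.X ◁ (dagger f ▷ B.X) ≫ (M.act ≫ f) ≫ dagger f := by
        rw [Category.assoc, hf.1, Category.comp_id]
    _ = A.X ◁ ((dagger f ≫ f) ▷ B.X) ≫ N.act ≫ dagger f := by rw [← hfa]; simp
    _ = _ := by rw [hf.2]; simp

theorem Isomorphic.trans {M N P : DaggerBimodule A B} (h : M.Isomorphic N) (h' : N.Isomorphic P) :
    M.Isomorphic P := by
  obtain ⟨f, hf, hfa⟩ := h
  obtain ⟨g, hg, hga⟩ := h'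
  refine ⟨f ≫ g, hf.comp hg, ?_⟩
  rw [← reassoc_of% hfa, ← hga]
  simp

theorem actLeft_naturality {M N : DaggerBimodule A B} {f : M.X ⟶ N.X}
    (h : A.X ◁ (f ▷ B.X) ≫ N.act = M.act ≫ f) : A.X ◁ f ≫ N.actLeft = M.actLeft ≫ f := by
  rw [actLeft, actLeft, Category.assoc, ← h, ← whiskerLeft_comp_assoc, ← whiskerLeft_comp_assoc]
  congr 2
  rw [Category.assoc, whisker_exchange, rightUnitor_inv_naturality_assoc]

theorem actRight_naturality {M N : DaggerBimodule A B} {f : M.X ⟶ N.X}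
    (h : A.X ◁ (f ▷ B.X) ≫ N.act = M.act ≫ f) : f ▷ B.X ≫ N.actRight = M.actRight ≫ f := by
  simp only [actRight, Category.assoc, ← h]
  rw [← whisker_exchange_assoc, leftUnitor_inv_naturality_assoc]

/-- The dagger of a morphism that commutes with the actions commutes with the actions. -/
theorem act_naturality_dagger [MonoidalDaggerCategory C] {M N : DaggerBimodule A B}
    {f : M.X ⟶ N.X} (h : A.X ◁ (f ▷ B.X) ≫ N.act = M.act ≫ f) :
    A.X ◁ (dagger f ▷ B.X) ≫ M.act = N.act ≫ dagger f := by
  have h' : dagger N.act ≫ A.X ◁ (dagger f ▷ B.X) = dagger f ≫ dagger M.act := by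
    rw [← dagger_comp, ← h, dagger_comp, dagger_whiskerLeft, dagger_whiskerRight]
  have hreb : A.X ◁ ((A.X ◁ (dagger f ▷ B.X)) ▷ B.X) ≫ (rebracket A.X M.X B.X).inv =
      (rebracket A.X N.X B.X).inv ≫ (A.X ⊗ A.X) ◁ (dagger f ▷ (B.X ⊗ B.X)) := by
    dsimp only [rebracket]
    monoidal
  have hcap : (A.X ⊗ A.X) ◁ (dagger f ▷ (B.X ⊗ B.X)) ≫ (A.cap ⊗ₘ (M.X ◁ B.cap)) =
      (A.cap ⊗ₘ (N.X ◁ B.cap)) ≫ 𝟙_ C ◁ (dagger f ▷ 𝟙_ C) := by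
    simp only [← id_tensorHom, ← tensorHom_id, tensorHom_comp_tensorHom, Category.id_comp,
      Category.comp_id]
  -- The dagger bimodule axiom rewrites both actions through their own daggers, so the daggered
  -- intertwining relation `h'` becomes applicable.
  conv_lhs => rw [← M.act_dagger]
  conv_rhs => rw [← N.act_dagger]
  rw [← whiskerLeft_comp_assoc, ← comp_whiskerRight, ← h', comp_whiskerRight, whiskerLeft_comp,
    Category.assoc, reassoc_of% hreb, reassoc_of% hcap, leftUnitor_naturality_assoc, rightUnitor_naturality]
  simp only [Category.assoc]

theorem relIdem_naturality {M M' : DaggerBimodule A B} {N N' : DaggerBimodule B D}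
    {f : M.X ⟶ M'.X} {g : N.X ⟶ N'.X} (hf : A.X ◁ (f ▷ B.X) ≫ M'.act = M.act ≫ f)
    (hg : B.X ◁ (g ▷ D.X) ≫ N'.act = N.act ≫ g) :
    relIdem M N ≫ (f ⊗ₘ g) = (f ⊗ₘ g) ≫ relIdem M' N' := by
  have hφ : ((λ_ N.X).inv ≫ B.cup ▷ N.X ≫ (α_ B.X B.X N.X).hom) ≫ B.X ◁ (B.X ◁ g) =
      g ≫ (λ_ N'.X).inv ≫ B.cup ▷ N'.X ≫ (α_ B.X B.X N'.X).hom := by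
    rw [leftUnitor_inv_naturality_assoc, whisker_exchange_assoc]
    simp
  have hα : (α_ M.X B.X (B.X ⊗ N.X)).inv ≫ (f ▷ B.X ⊗ₘ B.X ◁ g) =
      (f ⊗ₘ B.X ◁ (B.X ◁ g)) ≫ (α_ M'.X B.X (B.X ⊗ N'.X)).inv := by
    simp only [← tensorHom_id, ← id_tensorHom, associator_inv_naturality]
  simp only [relIdem, Category.assoc]
  rw [tensorHom_comp_tensorHom, ← actRight_naturality hf, ← actLeft_naturality hg,
    ← tensorHom_comp_tensorHom, reassoc_of% hα, ← id_tensorHom, tensorHom_comp_tensorHom_assoc,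
    hφ, Category.id_comp, ← id_tensorHom M'.X, tensorHom_comp_tensorHom_assoc, Category.comp_id]

/-- Relative tensor products of isomorphic dagger bimodules are isomorphic. -/
theorem IsRelativeTensorProduct.isomorphic [MonoidalDaggerCategory C] {M M' : DaggerBimodule A B}
    {N N' : DaggerBimodule B D} {T T' : DaggerBimodule A D} {i : T.X ⟶ M.X ⊗ N.X}
    {i' : T'.X ⟶ M'.X ⊗ N'.X} (h : IsRelativeTensorProduct M N T i)
    (h' : IsRelativeTensorProduct M' N' T' i') (hM : M.Isomorphic M') (hN : N.Isomorphic N') :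
    T.Isomorphic T' := by
  obtain ⟨f, hf, hfa⟩ := hM
  obtain ⟨g, hg, hga⟩ := hN
  have hn := relIdem_naturality hfa hga
  have hi : i ≫ dagger i = 𝟙 _ := h.splits.1
  have hi' : i' ≫ dagger i' = 𝟙 _ := h'.splits.1
  refine ⟨i ≫ (f ⊗ₘ g) ≫ dagger i', isUnitary_of_splits h.splits h'.splits (hf.tensorHom hg) hn,
    ?_⟩
  rw [← h.splits.2, ← h'.splits.2] at hn
  simp only [Category.assoc] at hn
  have hlam : A.X ◁ ((f ⊗ₘ g) ▷ D.X ≫ (α_ M'.X N'.X D.X).hom) ≫ (α_ A.X M'.X (N'.X ⊗ D.X)).inv ≫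
      (M'.actLeft ⊗ₘ N'.actRight) = A.X ◁ (α_ M.X N.X D.X).hom ≫ (α_ A.X M.X (N.X ⊗ D.X)).inv ≫
      (M.actLeft ⊗ₘ N.actRight) ≫ (f ⊗ₘ g) := by
    rw [tensorHom_comp_tensorHom, ← actLeft_naturality hfa, ← actRight_naturality hga,
      ← tensorHom_comp_tensorHom]
    simp only [← tensorHom_id, ← id_tensorHom, ← associator_inv_naturality_assoc,
      tensorHom_comp_tensorHom_assoc, associator_naturality, Category.id_comp]
  -- Since `f ⊗ g` intertwines the two idempotents, it carries the image of `i` into that of `i'`,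
  -- and projecting onto the latter changes nothing.
  have hj : (i ≫ (f ⊗ₘ g) ≫ dagger i') ≫ i' = i ≫ (f ⊗ₘ g) := by
    simp only [Category.assoc]
    rw [← hn, reassoc_of% hi]
  calc _ = A.X ◁ (((i ≫ (f ⊗ₘ g) ≫ dagger i') ≫ i') ▷ D.X) ≫ A.X ◁ (α_ M'.X N'.X D.X).hom ≫
        (α_ A.X M'.X (N'.X ⊗ D.X)).inv ≫ (M'.actLeft ⊗ₘ N'.actRight) ≫ dagger i' := by
        rw [h'.act_eq]; simp
    _ = A.X ◁ (i ▷ D.X) ≫ (A.X ◁ ((f ⊗ₘ g) ▷ D.X ≫ (α_ M'.X N'.X D.X).hom) ≫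
        (α_ A.X M'.X (N'.X ⊗ D.X)).inv ≫ (M'.actLeft ⊗ₘ N'.actRight)) ≫ dagger i' := by
        rw [hj]; simp only [comp_whiskerRight, whiskerLeft_comp, Category.assoc]
    _ = _ := by
        rw [hlam, h.act_eq]
        simp only [whiskerLeft_comp, Category.assoc]
        rw [reassoc_of% hn, hi', Category.comp_id]

end DaggerBimodule

end Monoidal

section Bicategories

open Bicategory DaggerCategory

variable {B : Type u} [Bicategory.{w, v} B] [DaggerBicategory B]

/-! ### The bimodules `X ⊗ F ⊗ Y*`. -/

namespace SpecialRightDual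

variable {r s t q : B} {X : r ⟶ s} {Y : r ⟶ t} {Z : r ⟶ q}

theorem counit_snake_left (d : SpecialRightDual X) :
    X ◁ d.adj.unit ≫ (α_ X d.dual X).inv ≫ d.adj.counit ▷ X = (ρ_ X).hom ≫ (λ_ X).inv := by
  have h := d.adj.right_triangle
  simpa [rightZigzag, bicategoricalComp] using h

theorem counit_snake_right (d : SpecialRightDual X) :
    d.adj.unit ▷ d.dual ≫ (α_ d.dual X d.dual).hom ≫ d.dual ◁ d.adj.counit =
      (λ_ d.dual).hom ≫ (ρ_ d.dual).inv := by
  have h := d.adj.left_triangle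
  simpa [leftZigzag, bicategoricalComp] using h

/-- The map `η† ⊗ F ⊗ η†`, which caps off a pair of wires on either side of `F`. -/
def capOff (dX : SpecialRightDual X) (dY : SpecialRightDual Y) (F : s ⟶ t) :
    (dX.dual ≫ X) ≫ F ≫ (dY.dual ≫ Y) ⟶ F :=
  (dX.dual ≫ X) ◁ (F ◁ dagger dY.adj.unit ≫ (ρ_ F).hom) ≫ dagger dX.adj.unit ▷ F ≫ (λ_ F).hom

theorem dagger_capOff (dX : SpecialRightDual X) (dY : SpecialRightDual Y) (F : s ⟶ t) :
    dagger (dX.capOff dY F) = (λ_ F).inv ≫ dX.adj.unit ▷ F ≫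
      (dX.dual ≫ X) ◁ ((ρ_ F).inv ≫ F ◁ dY.adj.unit) := by
  simp only [capOff, dagger_comp, dagger_whiskerLeft₂, dagger_whiskerRight₂, dagger_dagger,
    DaggerBicategory.dagger_leftUnitor, DaggerBicategory.dagger_rightUnitor, Category.assoc]

theorem capOff_naturality (dX : SpecialRightDual X) (dY : SpecialRightDual Y) {F G : s ⟶ t}
    (f : F ⟶ G) :
    (dX.dual ≫ X) ◁ (f ▷ (dY.dual ≫ Y)) ≫ dX.capOff dY G = dX.capOff dY F ≫ f := by
  simp only [capOff, Category.assoc]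
  rw [← leftUnitor_naturality, ← whisker_exchange_assoc, ← whiskerLeft_comp_assoc,
    ← whiskerLeft_comp_assoc, ← whisker_exchange_assoc, rightUnitor_naturality, Category.assoc]

/-- Each side contributes a closed loop `η† ∘ η`, which is the identity by specialness. Faithfulness
and fullness below both rest on this. -/
theorem dagger_capOff_capOff (dX : SpecialRightDual X) (dY : SpecialRightDual Y) (F : s ⟶ t) :
    dagger (dX.capOff dY F) ≫ dX.capOff dY F = 𝟙 F := by
  have hX : dX.adj.unit ≫ dagger dX.adj.unit = 𝟙 _ := dX.special
  have hY : dY.adj.unit ≫ dagger dY.adj.unit = 𝟙 _ := dY.special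
  rw [dagger_capOff, capOff]
  calc _ = (λ_ F).inv ≫ dX.adj.unit ▷ F ≫ (dX.dual ≫ X) ◁ ((ρ_ F).inv ≫
        F ◁ (dY.adj.unit ≫ dagger dY.adj.unit) ≫ (ρ_ F).hom) ≫
          dagger dX.adj.unit ▷ F ≫ (λ_ F).hom := by bicategory
    _ = (λ_ F).inv ≫ (dX.adj.unit ≫ dagger dX.adj.unit) ▷ F ≫ (λ_ F).hom := by
        rw [hY]; bicategory
    _ = _ := by rw [hX]; simp

/-- The action of `X ⊗ X*` and `Y ⊗ Y*` on `X ⊗ F ⊗ Y*`. -/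
def sandwichAct (dX : SpecialRightDual X) (dY : SpecialRightDual Y) (F : s ⟶ t) :
    (X ≫ dX.dual) ≫ (X ≫ F ≫ dY.dual) ≫ (Y ≫ dY.dual) ⟶ X ≫ F ≫ dY.dual :=
  (α_ X dX.dual _).hom ≫ X ◁ (dX.dual ◁ (α_ X (F ≫ dY.dual) (Y ≫ dY.dual)).hom ≫
    (α_ dX.dual X _).inv ≫ (dX.dual ≫ X) ◁ ((α_ F dY.dual (Y ≫ dY.dual)).hom ≫
      F ◁ (α_ dY.dual Y dY.dual).inv ≫ (α_ F (dY.dual ≫ Y) dY.dual).inv) ≫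
        (α_ (dX.dual ≫ X) (F ≫ (dY.dual ≫ Y)) dY.dual).inv ≫ dX.capOff dY F ▷ dY.dual)

theorem dagger_sandwichAct (dX : SpecialRightDual X) (dY : SpecialRightDual Y) (F : s ⟶ t) :
    dagger (dX.sandwichAct dY F) = X ◁ (dagger (dX.capOff dY F) ▷ dY.dual ≫
      (α_ (dX.dual ≫ X) (F ≫ (dY.dual ≫ Y)) dY.dual).hom ≫
      (dX.dual ≫ X) ◁ ((α_ F (dY.dual ≫ Y) dY.dual).hom ≫ F ◁ (α_ dY.dual Y dY.dual).hom ≫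
        (α_ F dY.dual (Y ≫ dY.dual)).inv) ≫ (α_ dX.dual X _).hom ≫
      dX.dual ◁ (α_ X (F ≫ dY.dual) (Y ≫ dY.dual)).inv) ≫ (α_ X dX.dual _).inv := by
  simp only [sandwichAct, dagger_comp, dagger_whiskerLeft₂, dagger_whiskerRight₂,
    dagger_associator_inv, DaggerBicategory.dagger_associator, Category.assoc]

theorem sandwichAct_naturality (dX : SpecialRightDual X) (dY : SpecialRightDual Y) {F G : s ⟶ t}
    (f : F ⟶ G) :
    (X ≫ dX.dual) ◁ ((X ◁ (f ▷ dY.dual)) ▷ (Y ≫ dY.dual)) ≫ dX.sandwichAct dY G =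
      dX.sandwichAct dY F ≫ X ◁ (f ▷ dY.dual) := by
  calc _ = 𝟙 _ ⊗≫ X ◁ (((dX.dual ≫ X) ◁ (f ▷ (dY.dual ≫ Y)) ≫ dX.capOff dY G) ▷ dY.dual)
        ⊗≫ 𝟙 _ := by dsimp only [sandwichAct]; bicategory
    _ = _ := by rw [capOff_naturality]; dsimp only [sandwichAct]; bicategory

theorem dagger_sandwichAct_sandwichAct (dX : SpecialRightDual X) (dY : SpecialRightDual Y)
    (F : s ⟶ t) : dagger (dX.sandwichAct dY F) ≫ dX.sandwichAct dY F = 𝟙 _ := by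
  rw [dagger_sandwichAct]
  calc _ = 𝟙 _ ⊗≫ X ◁ ((dagger (dX.capOff dY F) ≫ dX.capOff dY F) ▷ dY.dual)
        ⊗≫ 𝟙 _ := by dsimp only [sandwichAct]; bicategory
    _ = _ := by rw [dagger_capOff_capOff]; bicategory

/-- Naturality of `capOff`, applied to `capOff` itself, lets the outer pairs be capped before the
inner ones. This is associativity of the action with the outer `X` and `Y*` removed. -/
theorem capOff_capOff (dX : SpecialRightDual X) (dY : SpecialRightDual Y) (F : s ⟶ t) :
    (dX.dual ≫ X) ◁ (dX.capOff dY F ▷ (dY.dual ≫ Y)) ≫ dX.capOff dY F =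
      𝟙 _ ⊗≫ dagger dX.adj.unit ▷ ((dX.dual ≫ X) ≫ F ≫ (dY.dual ≫ Y) ≫ (dY.dual ≫ Y)) ⊗≫
        ((dX.dual ≫ X) ≫ F ≫ (dY.dual ≫ Y)) ◁ dagger dY.adj.unit ⊗≫ dX.capOff dY F := by
  rw [capOff_naturality]
  calc _ = 𝟙 _ ⊗≫ ((dX.dual ≫ X) ◁ (((dX.dual ≫ X) ≫ F ≫ (dY.dual ≫ Y)) ◁ dagger dY.adj.unit) ≫
        dagger dX.adj.unit ▷ (((dX.dual ≫ X) ≫ F ≫ (dY.dual ≫ Y)) ≫ 𝟙 t)) ⊗≫ dX.capOff dY F := by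
        rw [capOff]; bicategory
    _ = _ := by rw [whisker_exchange]; bicategory

theorem sandwichAct_mul (dX : SpecialRightDual X) (dY : SpecialRightDual Y) (F : s ⟶ t) :
    (dX.mul ▷ ((X ≫ F ≫ dY.dual) ≫ (Y ≫ dY.dual) ≫ (Y ≫ dY.dual)) ≫
      (X ≫ dX.dual) ◁ ((X ≫ F ≫ dY.dual) ◁ dY.mul)) ≫ dX.sandwichAct dY F =
      ((α_ (X ≫ dX.dual) (X ≫ dX.dual) _).hom ≫ (X ≫ dX.dual) ◁ ((X ≫ dX.dual) ◁
        (α_ (X ≫ F ≫ dY.dual) (Y ≫ dY.dual) (Y ≫ dY.dual)).inv ≫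
          (α_ (X ≫ dX.dual) _ (Y ≫ dY.dual)).inv)) ≫
      (X ≫ dX.dual) ◁ (dX.sandwichAct dY F ▷ (Y ≫ dY.dual)) ≫ dX.sandwichAct dY F := by
  -- The inner identity fixes the bracketing of the source so that the bracketed expression is
  -- literally the right side of `capOff_capOff`.
  calc _ = 𝟙 _ ⊗≫ X ◁ ((𝟙 ((dX.dual ≫ X) ≫ ((dX.dual ≫ X) ≫ F ≫ (dY.dual ≫ Y)) ≫
          (dY.dual ≫ Y)) ⊗≫ dagger dX.adj.unit ▷ ((dX.dual ≫ X) ≫ F ≫ (dY.dual ≫ Y) ≫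
          (dY.dual ≫ Y)) ⊗≫
        ((dX.dual ≫ X) ≫ F ≫ (dY.dual ≫ Y)) ◁ dagger dY.adj.unit ⊗≫ dX.capOff dY F) ▷ dY.dual)
        ⊗≫ 𝟙 _ := by dsimp only [sandwichAct, mul]; bicategory
    _ = _ := by rw [← capOff_capOff]; dsimp only [sandwichAct]; bicategory

/-- The pairs created by the two units are straightened by one daggered snake on each side; the
interchange law separates the two snakes. -/
theorem sandwichAct_unit (dX : SpecialRightDual X) (dY : SpecialRightDual Y) (F : s ⟶ t) :
    (dagger dX.adj.counit ▷ ((X ≫ F ≫ dY.dual) ≫ 𝟙 r) ≫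
      (X ≫ dX.dual) ◁ ((X ≫ F ≫ dY.dual) ◁ dagger dY.adj.counit)) ≫ dX.sandwichAct dY F =
      (λ_ ((X ≫ F ≫ dY.dual) ≫ 𝟙 r)).hom ≫ (ρ_ (X ≫ F ≫ dY.dual)).hom := by
  rw [← whisker_exchange]
  calc _ = 𝟙 _ ⊗≫ (X ≫ F) ◁ (dY.dual ◁ dagger dY.adj.counit) ⊗≫
        (dagger dX.adj.counit ▷ ((X ≫ F) ≫ (dY.dual ≫ Y)) ≫
          (X ≫ dX.dual) ◁ ((X ≫ F) ◁ dagger dY.adj.unit)) ▷ dY.dual ⊗≫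
        X ◁ (dagger dX.adj.unit ▷ (F ≫ dY.dual)) ⊗≫ 𝟙 _ := by
        dsimp only [sandwichAct, capOff]; bicategory
    _ = 𝟙 _ ⊗≫ (X ≫ F) ◁ (dY.dual ◁ dagger dY.adj.counit ≫ (α_ dY.dual Y dY.dual).inv ≫
          dagger dY.adj.unit ▷ dY.dual) ⊗≫
        (dagger dX.adj.counit ▷ X ≫ (α_ X dX.dual X).hom ≫
          X ◁ dagger dX.adj.unit) ▷ (F ≫ dY.dual) ⊗≫ 𝟙 _ := by
        rw [← whisker_exchange]; bicategory
    _ = _ := by rw [snake_left, snake_right]; bicategory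

/-- The dagger of the action creates `η` on both sides of `F`. Interchange slides each `η` past the
`η†` of a multiplication, after which it forms an undaggered snake with `ε`; the two remaining `η†`
are the action. -/
theorem sandwichAct_dagger (dX : SpecialRightDual X) (dY : SpecialRightDual Y) (F : s ⟶ t) :
    (X ≫ dX.dual) ◁ (dagger (dX.sandwichAct dY F) ▷ (Y ≫ dY.dual)) ≫
      ((X ≫ dX.dual) ◁ ((α_ (X ≫ dX.dual) ((X ≫ F ≫ dY.dual) ≫ (Y ≫ dY.dual)) (Y ≫ dY.dual)).hom ≫
        (X ≫ dX.dual) ◁ (α_ (X ≫ F ≫ dY.dual) (Y ≫ dY.dual) (Y ≫ dY.dual)).hom) ≫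
          (α_ (X ≫ dX.dual) (X ≫ dX.dual) _).inv) ≫
      ((dX.mul ≫ dX.adj.counit) ▷ ((X ≫ F ≫ dY.dual) ≫ (Y ≫ dY.dual) ≫ (Y ≫ dY.dual)) ≫
        𝟙 r ◁ ((X ≫ F ≫ dY.dual) ◁ (dY.mul ≫ dY.adj.counit))) ≫
      (λ_ ((X ≫ F ≫ dY.dual) ≫ 𝟙 r)).hom ≫ (ρ_ (X ≫ F ≫ dY.dual)).hom =
      dX.sandwichAct dY F := by
  rw [dagger_sandwichAct, dagger_capOff]
  calc _ = 𝟙 _ ⊗≫ (X ≫ dX.dual ≫ X) ◁ (dX.adj.unit ▷ (F ≫ dY.dual ≫ Y ≫ dY.dual)) ⊗≫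
        (((X ≫ dX.dual) ≫ (X ≫ dX.dual)) ◁ ((X ≫ F) ◁ dY.adj.unit) ≫
          (dX.mul ≫ dX.adj.counit) ▷ ((X ≫ F) ≫ (dY.dual ≫ Y))) ▷ (dY.dual ≫ Y ≫ dY.dual) ⊗≫
        (X ≫ F ≫ dY.dual) ◁ (dY.mul ≫ dY.adj.counit) ⊗≫ 𝟙 _ := by bicategory
    _ = 𝟙 _ ⊗≫ X ◁ ((dX.dual ≫ X) ◁ dX.adj.unit ≫ dagger dX.adj.unit ▷ (dX.dual ≫ X)) ▷
          (F ≫ dY.dual ≫ Y ≫ dY.dual) ⊗≫ dX.adj.counit ▷ (X ≫ F ≫ dY.dual ≫ Y ≫ dY.dual) ⊗≫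
        (X ≫ F) ◁ (dY.adj.unit ▷ (dY.dual ≫ Y) ≫ (dY.dual ≫ Y) ◁ dagger dY.adj.unit) ▷ dY.dual ⊗≫
        (X ≫ F ≫ dY.dual) ◁ dY.adj.counit ⊗≫ 𝟙 _ := by
        rw [whisker_exchange]; dsimp only [mul]; bicategory
    _ = 𝟙 _ ⊗≫ X ◁ dagger dX.adj.unit ▷ (F ≫ dY.dual ≫ Y ≫ dY.dual) ⊗≫
        (X ◁ dX.adj.unit ≫ (α_ X dX.dual X).inv ≫ dX.adj.counit ▷ X) ▷
          (F ≫ dY.dual ≫ Y ≫ dY.dual) ⊗≫ (X ≫ F) ◁ dagger dY.adj.unit ▷ dY.dual ⊗≫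
        (X ≫ F) ◁ (dY.adj.unit ▷ dY.dual ≫ (α_ dY.dual Y dY.dual).hom ≫
          dY.dual ◁ dY.adj.counit) ⊗≫ 𝟙 _ := by
        rw [← whisker_exchange dY.adj.unit, whisker_exchange]; bicategory
    _ = 𝟙 _ ⊗≫ X ◁ (dagger dX.adj.unit ▷ (F ≫ (dY.dual ≫ Y)) ≫
        𝟙 s ◁ (F ◁ dagger dY.adj.unit)) ▷ dY.dual ⊗≫ 𝟙 _ := by
        rw [counit_snake_left, counit_snake_right]; bicategory
    _ = _ := by rw [← whisker_exchange]; dsimp only [sandwichAct, capOff]; bicategory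

/-- The dagger bimodule `X ⊗ F ⊗ Y*`. -/
def sandwich (dX : SpecialRightDual X) (dY : SpecialRightDual Y) (F : s ⟶ t) :
    DaggerBimodule dX.frobeniusMonoid dY.frobeniusMonoid where
  X := X ≫ F ≫ dY.dual
  act := dX.sandwichAct dY F
  act_mul := dX.sandwichAct_mul dY F
  act_unit := dX.sandwichAct_unit dY F
  act_dagger := by
    have h := dX.sandwichAct_dagger dY F
    have hX : dagger (dX.frobeniusMonoid).u = dX.adj.counit := dagger_dagger _
    have hY : dagger (dY.frobeniusMonoid).u = dY.adj.counit := dagger_dagger _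
    rw [SpecialFrobeniusMonoid.cap, SpecialFrobeniusMonoid.cap, hX, hY]
    exact h

/-! ### Full faithfulness of `F ↦ X ⊗ F ⊗ Y*`. -/

theorem whiskerLeft_whiskerRight_injective (dX : SpecialRightDual X) (dY : SpecialRightDual Y)
    {F G : s ⟶ t} {f g : F ⟶ G} (h : X ◁ (f ▷ dY.dual) = X ◁ (g ▷ dY.dual)) : f = g := by
  -- An explicit left inverse of whiskering: add `X*` and `Y` outside, then conjugate with `capOff`.
  have key (k : F ⟶ G) : dagger (dX.capOff dY F) ≫ ((α_ dX.dual X _).hom ≫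
      dX.dual ◁ (X ◁ (α_ F dY.dual Y).inv ≫ (α_ X (F ≫ dY.dual) Y).inv)) ≫
      dX.dual ◁ ((X ◁ (k ▷ dY.dual)) ▷ Y) ≫
      (dX.dual ◁ ((α_ X (G ≫ dY.dual) Y).hom ≫ X ◁ (α_ G dY.dual Y).hom) ≫
        (α_ dX.dual X _).inv) ≫ dX.capOff dY G = k := by
    calc _ = dagger (dX.capOff dY F) ≫ (dX.dual ≫ X) ◁ (k ▷ (dY.dual ≫ Y)) ≫ dX.capOff dY G := by
          bicategory
      _ = k := by
          rw [capOff_naturality, reassoc_of% dX.dagger_capOff_capOff dY F]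
  rw [← key f, ← key g, h]

theorem isUnitary_whisker {F G : s ⟶ t} (X : r ⟶ s) (W : t ⟶ q) {f : F ⟶ G} (hf : IsUnitary f) :
    IsUnitary (X ◁ (f ▷ W)) := by
  constructor
  · rw [dagger_whiskerLeft₂, dagger_whiskerRight₂, ← whiskerLeft_comp, ← comp_whiskerRight, hf.1]
    simp
  · rw [dagger_whiskerLeft₂, dagger_whiskerRight₂, ← whiskerLeft_comp, ← comp_whiskerRight, hf.2]
    simp

theorem isUnitary_of_isUnitary_whisker (dX : SpecialRightDual X) (dY : SpecialRightDual Y)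
    {F G : s ⟶ t} {f : F ⟶ G} (hf : IsUnitary (X ◁ (f ▷ dY.dual))) : IsUnitary f := by
  obtain ⟨h₁, h₂⟩ := hf
  rw [dagger_whiskerLeft₂, dagger_whiskerRight₂, ← whiskerLeft_comp, ← comp_whiskerRight] at h₁ h₂
  constructor
  · exact dX.whiskerLeft_whiskerRight_injective dY (by rw [h₁, id_whiskerRight, whiskerLeft_id])
  · exact dX.whiskerLeft_whiskerRight_injective dY (by rw [h₂, id_whiskerRight, whiskerLeft_id])

theorem sandwich_isomorphic (dX : SpecialRightDual X) (dY : SpecialRightDual Y) {F G : s ⟶ t}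
    {f : F ⟶ G} (hf : IsUnitary f) : (dX.sandwich dY F).Isomorphic (dX.sandwich dY G) :=
  ⟨X ◁ (f ▷ dY.dual), isUnitary_whisker X dY.dual hf, dX.sandwichAct_naturality dY f⟩

/-- Every morphism of dagger bimodules `X ⊗ F ⊗ Y* ⟶ X ⊗ G ⊗ Y*` comes from a 2-morphism
`F ⟶ G`. -/
theorem exists_eq_whisker (dX : SpecialRightDual X) (dY : SpecialRightDual Y) {F G : s ⟶ t}
    {f : X ≫ F ≫ dY.dual ⟶ X ≫ G ≫ dY.dual}
    (hf : (X ≫ dX.dual) ◁ (f ▷ (Y ≫ dY.dual)) ≫ dX.sandwichAct dY G =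
      dX.sandwichAct dY F ≫ f) : ∃ g : F ⟶ G, f = X ◁ (g ▷ dY.dual) := by
  refine ⟨dagger (dX.capOff dY F) ≫ ((α_ dX.dual X _).hom ≫
      dX.dual ◁ (X ◁ (α_ F dY.dual Y).inv ≫ (α_ X (F ≫ dY.dual) Y).inv)) ≫
      dX.dual ◁ (f ▷ Y) ≫
      (dX.dual ◁ ((α_ X (G ≫ dY.dual) Y).hom ≫ X ◁ (α_ G dY.dual Y).hom) ≫
        (α_ dX.dual X _).inv) ≫ dX.capOff dY G, ?_⟩
  -- As the action composed with its dagger is the identity, `f` equals its own conjugate by the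
  -- actions. There `f` sits strictly inside an outer `X` and `Y*`, which the actions leave
  -- untouched.
  calc f = dagger (dX.sandwichAct dY F) ≫ (X ≫ dX.dual) ◁ (f ▷ (Y ≫ dY.dual)) ≫
        dX.sandwichAct dY G := by
        rw [hf, reassoc_of% dX.dagger_sandwichAct_sandwichAct dY F]
    _ = _ := by rw [dagger_sandwichAct]; dsimp only [sandwichAct]; bicategory

theorem exists_isUnitary_of_sandwich_isomorphic (dX : SpecialRightDual X)
    (dY : SpecialRightDual Y) {F G : s ⟶ t}
    (h : (dX.sandwich dY F).Isomorphic (dX.sandwich dY G)) : ∃ g : F ⟶ G, IsUnitary g := by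
  obtain ⟨f, hu, hf⟩ := h
  obtain ⟨g, rfl⟩ := dX.exists_eq_whisker dY hf
  exact ⟨g, dX.isUnitary_of_isUnitary_whisker dY hu⟩

/-! ### Compatibility with identities and composition. -/

theorem trivialBimodule_isomorphic_sandwich (d : SpecialRightDual X) :
    d.frobeniusMonoid.trivialBimodule.Isomorphic (d.sandwich d (𝟙 s)) := by
  have hu : IsUnitary (X ◁ (λ_ d.dual).inv) := by
    constructor <;> rw [dagger_whiskerLeft₂, dagger_leftUnitor_inv, ← whiskerLeft_comp] <;> simp
  refine ⟨X ◁ (λ_ d.dual).inv, hu, ?_⟩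
  change (X ≫ d.dual) ◁ ((X ◁ (λ_ d.dual).inv) ▷ (X ≫ d.dual)) ≫ d.sandwichAct d (𝟙 s) =
    ((X ≫ d.dual) ◁ d.mul ≫ d.mul) ≫ X ◁ (λ_ d.dual).inv
  dsimp only [sandwichAct, capOff, mul]
  bicategory

/-- The unit of `Y ⊗ Y*` and the cap `η†` of `Y` cancel in a snake, leaving only the cap of `X`. -/
theorem actLeft_sandwich (dX : SpecialRightDual X) (dY : SpecialRightDual Y) (F : s ⟶ t) :
    (dX.sandwich dY F).actLeft = (α_ X dX.dual (X ≫ F ≫ dY.dual)).hom ≫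
      X ◁ ((α_ dX.dual X (F ≫ dY.dual)).inv ≫ dagger dX.adj.unit ▷ (F ≫ dY.dual) ≫
        (λ_ (F ≫ dY.dual)).hom) := by
  change (X ≫ dX.dual) ◁ ((ρ_ (X ≫ F ≫ dY.dual)).inv ≫
    (X ≫ F ≫ dY.dual) ◁ dagger dY.adj.counit) ≫ dX.sandwichAct dY F = _
  calc _ = 𝟙 _ ⊗≫ (X ≫ dX.dual ≫ X ≫ F) ◁ (dY.dual ◁ dagger dY.adj.counit ≫
          (α_ dY.dual Y dY.dual).inv ≫ dagger dY.adj.unit ▷ dY.dual) ⊗≫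
        X ◁ (dagger dX.adj.unit ▷ (F ≫ dY.dual)) ⊗≫ 𝟙 _ := by
        dsimp only [sandwichAct, capOff]; bicategory
    _ = _ := by rw [snake_right]; bicategory

theorem actRight_sandwich (dX : SpecialRightDual X) (dY : SpecialRightDual Y) (F : s ⟶ t) :
    (dX.sandwich dY F).actRight = (α_ X (F ≫ dY.dual) (Y ≫ dY.dual)).hom ≫
      X ◁ ((α_ F dY.dual (Y ≫ dY.dual)).hom ≫ F ◁ ((α_ dY.dual Y dY.dual).inv ≫
        dagger dY.adj.unit ▷ dY.dual ≫ (λ_ dY.dual).hom)) := by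
  change (λ_ ((X ≫ F ≫ dY.dual) ≫ (Y ≫ dY.dual))).inv ≫
    dagger dX.adj.counit ▷ ((X ≫ F ≫ dY.dual) ≫ (Y ≫ dY.dual)) ≫ dX.sandwichAct dY F = _
  calc _ = 𝟙 _ ⊗≫ (dagger dX.adj.counit ▷ ((X ≫ F) ≫ (dY.dual ≫ Y)) ≫
          (X ≫ dX.dual) ◁ ((X ≫ F) ◁ dagger dY.adj.unit)) ▷ dY.dual ⊗≫
        X ◁ (dagger dX.adj.unit ▷ (F ≫ dY.dual)) ⊗≫ 𝟙 _ := by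
        dsimp only [sandwichAct, capOff]; bicategory
    _ = 𝟙 _ ⊗≫ (X ≫ F) ◁ dagger dY.adj.unit ▷ dY.dual ⊗≫ (dagger dX.adj.counit ▷ X ≫
          (α_ X dX.dual X).hom ≫ X ◁ dagger dX.adj.unit) ▷ (F ≫ dY.dual) ⊗≫ 𝟙 _ := by
        rw [← whisker_exchange]; bicategory
    _ = _ := by rw [snake_left]; bicategory

/-- The isometry `X ⊗ (F ⊗ G) ⊗ Z* ⟶ (X ⊗ F ⊗ Y*) ⊗ (Y ⊗ G ⊗ Z*)` given by the cup of `Y`. -/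
def insertCup (X : r ⟶ s) (dY : SpecialRightDual Y) (F : s ⟶ t) (G : t ⟶ q) (W : q ⟶ r) :
    X ≫ (F ≫ G) ≫ W ⟶ (X ≫ F ≫ dY.dual) ≫ (Y ≫ G ≫ W) :=
  X ◁ ((α_ F G W).hom ≫ F ◁ ((λ_ (G ≫ W)).inv ≫ dY.adj.unit ▷ (G ≫ W) ≫
    (α_ dY.dual Y (G ≫ W)).hom) ≫ (α_ F dY.dual (Y ≫ G ≫ W)).inv) ≫
      (α_ X (F ≫ dY.dual) (Y ≫ G ≫ W)).inv

theorem dagger_insertCup (X : r ⟶ s) (dY : SpecialRightDual Y) (F : s ⟶ t) (G : t ⟶ q)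
    (W : q ⟶ r) : dagger (insertCup X dY F G W) = (α_ X (F ≫ dY.dual) (Y ≫ G ≫ W)).hom ≫
      X ◁ ((α_ F dY.dual (Y ≫ G ≫ W)).hom ≫ F ◁ ((α_ dY.dual Y (G ≫ W)).inv ≫
        dagger dY.adj.unit ▷ (G ≫ W) ≫ (λ_ (G ≫ W)).hom) ≫ (α_ F G W).inv) := by
  simp only [insertCup, dagger_comp, dagger_whiskerLeft₂, dagger_whiskerRight₂,
    dagger_associator_inv, DaggerBicategory.dagger_associator, dagger_leftUnitor_inv,
    Category.assoc]

theorem insertCup_dagger_insertCup (X : r ⟶ s) (dY : SpecialRightDual Y) (F : s ⟶ t) (G : t ⟶ q)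
    (W : q ⟶ r) : insertCup X dY F G W ≫ dagger (insertCup X dY F G W) = 𝟙 _ := by
  have hY : dY.adj.unit ≫ dagger dY.adj.unit = 𝟙 _ := dY.special
  rw [dagger_insertCup, insertCup]
  calc _ = 𝟙 _ ⊗≫ (X ≫ F) ◁ (dY.adj.unit ≫ dagger dY.adj.unit) ▷ (G ≫ W) ⊗≫ 𝟙 _ := by
        bicategory
    _ = _ := by rw [hY]; bicategory

/-- The cup of `Y ⊗ Y*` is `ε†` followed by an inserted `η`. One snake absorbs `ε†` together with
one of the two caps, so only `η ∘ η†` survives between `F` and `G`. -/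
theorem relIdem_sandwich (dX : SpecialRightDual X) (dY : SpecialRightDual Y)
    (dZ : SpecialRightDual Z) (F : s ⟶ t) (G : t ⟶ q) :
    dagger (insertCup X dY F G dZ.dual) ≫ insertCup X dY F G dZ.dual =
      DaggerBimodule.relIdem (dX.sandwich dY F) (dY.sandwich dZ G) := by
  have h : dY.frobeniusMonoid.cup = dagger dY.adj.counit ≫ dagger dY.mul := rfl
  rw [DaggerBimodule.relIdem, h, actRight_sandwich, actLeft_sandwich, dagger_insertCup, insertCup,
    dagger_mul]
  symm
  change (X ≫ F ≫ dY.dual) ◁ ((λ_ (Y ≫ G ≫ dZ.dual)).inv ≫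
    (dagger dY.adj.counit ≫ Y ◁ ((λ_ dY.dual).inv ≫ dY.adj.unit ▷ dY.dual ≫
      (α_ dY.dual Y dY.dual).hom) ≫ (α_ Y dY.dual (Y ≫ dY.dual)).inv) ▷ (Y ≫ G ≫ dZ.dual) ≫
    (α_ (Y ≫ dY.dual) (Y ≫ dY.dual) (Y ≫ G ≫ dZ.dual)).hom) ≫
    (α_ (X ≫ F ≫ dY.dual) (Y ≫ dY.dual) ((Y ≫ dY.dual) ≫ (Y ≫ G ≫ dZ.dual))).inv ≫
    ((α_ X (F ≫ dY.dual) (Y ≫ dY.dual)).hom ≫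
      X ◁ ((α_ F dY.dual (Y ≫ dY.dual)).hom ≫ F ◁ ((α_ dY.dual Y dY.dual).inv ≫
        dagger dY.adj.unit ▷ dY.dual ≫ (λ_ dY.dual).hom))) ▷
          ((Y ≫ dY.dual) ≫ (Y ≫ G ≫ dZ.dual)) ≫
    (X ≫ F ≫ dY.dual) ◁ ((α_ Y dY.dual (Y ≫ G ≫ dZ.dual)).hom ≫
      Y ◁ ((α_ dY.dual Y (G ≫ dZ.dual)).inv ≫ dagger dY.adj.unit ▷ (G ≫ dZ.dual) ≫
        (λ_ (G ≫ dZ.dual)).hom)) = _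
  calc _ = 𝟙 _ ⊗≫ (X ≫ F ≫ dY.dual) ◁ dagger dY.adj.counit ▷ (Y ≫ G ≫ dZ.dual) ⊗≫
        (X ≫ F) ◁ ((dY.dual ≫ Y) ◁ dY.adj.unit ≫ dagger dY.adj.unit ▷ (dY.dual ≫ Y)) ▷
          (dY.dual ≫ Y ≫ G ≫ dZ.dual) ⊗≫
        (X ≫ F ≫ dY.dual ≫ Y) ◁ dagger dY.adj.unit ▷ (G ≫ dZ.dual) ⊗≫ 𝟙 _ := by bicategory
    _ = 𝟙 _ ⊗≫ (X ≫ F) ◁ (dY.dual ◁ dagger dY.adj.counit ≫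
          (α_ dY.dual Y dY.dual).inv ≫ dagger dY.adj.unit ▷ dY.dual) ▷ (Y ≫ G ≫ dZ.dual) ⊗≫
        (X ≫ F) ◁ (dY.adj.unit ▷ (dY.dual ≫ Y) ≫ (dY.dual ≫ Y) ◁ dagger dY.adj.unit) ▷
          (G ≫ dZ.dual) ⊗≫ 𝟙 _ := by
        rw [whisker_exchange]; bicategory
    _ = 𝟙 _ ⊗≫ (X ≫ F) ◁ (𝟙 t ◁ dagger dY.adj.unit ≫ dY.adj.unit ▷ 𝟙 t) ▷
          (G ≫ dZ.dual) ⊗≫ 𝟙 _ := by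
        rw [snake_right, ← whisker_exchange]; bicategory
    _ = _ := by bicategory

/-- The outer actions slide past the inserted cup of `Y`, which then closes up to the loop `η† ∘ η =
id`. -/
theorem sandwichAct_comp (dX : SpecialRightDual X) (dY : SpecialRightDual Y)
    (dZ : SpecialRightDual Z) (F : s ⟶ t) (G : t ⟶ q) :
    dX.sandwichAct dZ (F ≫ G) = (X ≫ dX.dual) ◁ (insertCup X dY F G dZ.dual ▷ (Z ≫ dZ.dual) ≫
        (α_ (X ≫ F ≫ dY.dual) (Y ≫ G ≫ dZ.dual) (Z ≫ dZ.dual)).hom) ≫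
      (α_ (X ≫ dX.dual) (X ≫ F ≫ dY.dual) ((Y ≫ G ≫ dZ.dual) ≫ (Z ≫ dZ.dual))).inv ≫
      (((α_ X dX.dual (X ≫ F ≫ dY.dual)).hom ≫
        X ◁ ((α_ dX.dual X (F ≫ dY.dual)).inv ≫ dagger dX.adj.unit ▷ (F ≫ dY.dual) ≫
          (λ_ (F ≫ dY.dual)).hom)) ▷ ((Y ≫ G ≫ dZ.dual) ≫ (Z ≫ dZ.dual)) ≫
      (X ≫ F ≫ dY.dual) ◁ ((α_ Y (G ≫ dZ.dual) (Z ≫ dZ.dual)).hom ≫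
        Y ◁ ((α_ G dZ.dual (Z ≫ dZ.dual)).hom ≫ G ◁ ((α_ dZ.dual Z dZ.dual).inv ≫
          dagger dZ.adj.unit ▷ dZ.dual ≫ (λ_ dZ.dual).hom)))) ≫
      dagger (insertCup X dY F G dZ.dual) := by
  symm
  rw [dagger_insertCup]
  calc _ = 𝟙 _ ⊗≫ X ◁ (((dX.dual ≫ X) ◁ (F ◁ dY.adj.unit) ≫
          dagger dX.adj.unit ▷ (F ≫ (dY.dual ≫ Y))) ▷ (G ≫ dZ.dual ≫ Z ≫ dZ.dual)) ⊗≫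
        (X ≫ F) ◁ ((dY.dual ≫ Y) ◁ (G ◁ dagger dZ.adj.unit) ≫ dagger dY.adj.unit ▷ (G ≫ 𝟙 q)) ▷
          dZ.dual ⊗≫ 𝟙 _ := by dsimp only [insertCup]; bicategory
    _ = 𝟙 _ ⊗≫ X ◁ (dagger dX.adj.unit ▷ (F ≫ G ≫ dZ.dual ≫ Z ≫ dZ.dual)) ⊗≫
        (X ≫ F) ◁ (dY.adj.unit ≫ dagger dY.adj.unit) ▷ (G ≫ dZ.dual ≫ Z ≫ dZ.dual) ⊗≫
        (X ≫ F ≫ G) ◁ dagger dZ.adj.unit ▷ dZ.dual ⊗≫ 𝟙 _ := by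
        rw [whisker_exchange, whisker_exchange]; bicategory
    _ = 𝟙 _ ⊗≫ X ◁ (dagger dX.adj.unit ▷ ((F ≫ G) ≫ (dZ.dual ≫ Z)) ≫
          𝟙 s ◁ ((F ≫ G) ◁ dagger dZ.adj.unit)) ▷ dZ.dual ⊗≫ 𝟙 _ := by
        rw [show dY.adj.unit ≫ dagger dY.adj.unit = 𝟙 _ from dY.special]; bicategory
    _ = _ := by rw [← whisker_exchange]; dsimp only [sandwichAct, capOff]; bicategory

theorem isRelativeTensorProduct_sandwich (dX : SpecialRightDual X) (dY : SpecialRightDual Y)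
    (dZ : SpecialRightDual Z) (F : s ⟶ t) (G : t ⟶ q) :
    DaggerBimodule.IsRelativeTensorProduct (dX.sandwich dY F) (dY.sandwich dZ G)
      (dX.sandwich dZ (F ≫ G)) (insertCup X dY F G dZ.dual) where
  splits := ⟨insertCup_dagger_insertCup X dY F G dZ.dual, relIdem_sandwich dX dY dZ F G⟩
  act_eq := by
    rw [actLeft_sandwich, actRight_sandwich]
    exact sandwichAct_comp dX dY dZ F G

/-! ### Essential surjectivity. -/

/-- The map `X ⊗ (X* ⊗ M ⊗ Y) ⊗ Y* ⟶ M` given by the action on the bimodule `M`. -/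
def evalAct (dX : SpecialRightDual X) (dY : SpecialRightDual Y)
    (M : DaggerBimodule dX.frobeniusMonoid dY.frobeniusMonoid) :
    X ≫ (dX.dual ≫ M.X ≫ Y) ≫ dY.dual ⟶ M.X :=
  (X ◁ ((α_ dX.dual (M.X ≫ Y) dY.dual).hom ≫ dX.dual ◁ (α_ M.X Y dY.dual).hom) ≫
    (α_ X dX.dual (M.X ≫ Y ≫ dY.dual)).inv) ≫ M.act

theorem evalAct_naturality (dX : SpecialRightDual X) (dY : SpecialRightDual Y)
    (M : DaggerBimodule dX.frobeniusMonoid dY.frobeniusMonoid) :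
    (X ≫ dX.dual) ◁ (evalAct dX dY M ▷ (Y ≫ dY.dual)) ≫ M.act =
      dX.sandwichAct dY (dX.dual ≫ M.X ≫ Y) ≫ evalAct dX dY M := by
  have h : (dX.mul ▷ (M.X ≫ (Y ≫ dY.dual) ≫ (Y ≫ dY.dual)) ≫
      (X ≫ dX.dual) ◁ (M.X ◁ dY.mul)) ≫ M.act =
      ((α_ (X ≫ dX.dual) (X ≫ dX.dual) (M.X ≫ (Y ≫ dY.dual) ≫ (Y ≫ dY.dual))).hom ≫
        (X ≫ dX.dual) ◁ ((X ≫ dX.dual) ◁ (α_ M.X (Y ≫ dY.dual) (Y ≫ dY.dual)).inv ≫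
          (α_ (X ≫ dX.dual) (M.X ≫ Y ≫ dY.dual) (Y ≫ dY.dual)).inv)) ≫
      (X ≫ dX.dual) ◁ (M.act ▷ (Y ≫ dY.dual)) ≫ M.act := M.act_mul
  calc _ = 𝟙 _ ⊗≫ (((α_ (X ≫ dX.dual) (X ≫ dX.dual) (M.X ≫ (Y ≫ dY.dual) ≫ (Y ≫ dY.dual))).hom ≫
        (X ≫ dX.dual) ◁ ((X ≫ dX.dual) ◁ (α_ M.X (Y ≫ dY.dual) (Y ≫ dY.dual)).inv ≫
          (α_ (X ≫ dX.dual) (M.X ≫ Y ≫ dY.dual) (Y ≫ dY.dual)).inv)) ≫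
        (X ≫ dX.dual) ◁ (M.act ▷ (Y ≫ dY.dual)) ≫ M.act) := by
        dsimp only [evalAct]; bicategory
    _ = 𝟙 _ ⊗≫ (dX.mul ▷ (M.X ≫ (Y ≫ dY.dual) ≫ (Y ≫ dY.dual)) ≫
        (X ≫ dX.dual) ◁ (M.X ◁ dY.mul)) ≫ M.act := by rw [h]
    _ = _ := by
        rw [← whisker_exchange]
        dsimp only [evalAct, sandwichAct, capOff, mul]
        bicategory

/-- Up to rebracketing this says that the action of any dagger bimodule is a coisometry. That is
known for bimodules `X ⊗ F ⊗ Y*`, and it passes to `M` along the bimodule map `evalAct`, which has a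
section. -/
theorem dagger_evalAct_evalAct (dX : SpecialRightDual X) (dY : SpecialRightDual Y)
    (M : DaggerBimodule dX.frobeniusMonoid dY.frobeniusMonoid) :
    dagger (evalAct dX dY M) ≫ evalAct dX dY M = 𝟙 M.X := by
  have hσ := dX.evalAct_naturality dY M
  have hσ' : (X ≫ dX.dual) ◁ (dagger (evalAct dX dY M) ▷ (Y ≫ dY.dual)) ≫
      dX.sandwichAct dY (dX.dual ≫ M.X ≫ Y) = M.act ≫ dagger (evalAct dX dY M) :=
    DaggerBimodule.act_naturality_dagger (M := dX.sandwich dY _) (N := M)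
      (f := evalAct dX dY M) hσ
  have hd := congrArg dagger hσ'
  rw [dagger_comp, dagger_comp, dagger_whiskerLeft₂, dagger_whiskerRight₂, dagger_dagger] at hd
  have hu : (dagger dX.adj.counit ▷ (M.X ≫ 𝟙 r) ≫ (X ≫ dX.dual) ◁ (M.X ◁ dagger dY.adj.counit)) ≫
      M.act = (λ_ (M.X ≫ 𝟙 r)).hom ≫ (ρ_ M.X).hom := M.act_unit
  -- The section inserts the units of both Frobenius monoids.
  have hs : ∃ k, k ≫ evalAct dX dY M = 𝟙 M.X := by
    refine ⟨(ρ_ M.X).inv ≫ (λ_ (M.X ≫ 𝟙 r)).inv ≫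
      (dagger dX.adj.counit ▷ (M.X ≫ 𝟙 r) ≫ (X ≫ dX.dual) ◁ (M.X ◁ dagger dY.adj.counit)) ≫
      (α_ X dX.dual (M.X ≫ Y ≫ dY.dual)).hom ≫
      X ◁ (dX.dual ◁ (α_ M.X Y dY.dual).inv ≫ (α_ dX.dual (M.X ≫ Y) dY.dual).inv), ?_⟩
    calc _ = (ρ_ M.X).inv ≫ (λ_ (M.X ≫ 𝟙 r)).inv ≫ (dagger dX.adj.counit ▷ (M.X ≫ 𝟙 r) ≫
          (X ≫ dX.dual) ◁ (M.X ◁ dagger dY.adj.counit)) ≫ M.act := by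
          dsimp only [evalAct]; bicategory
      _ = _ := by rw [hu]; simp
  have hact : dagger (evalAct dX dY M) ≫ evalAct dX dY M = dagger M.act ≫ M.act := by
    have h : dagger (evalAct dX dY M) = dagger M.act ≫ (α_ X dX.dual (M.X ≫ Y ≫ dY.dual)).hom ≫
        X ◁ (dX.dual ◁ (α_ M.X Y dY.dual).inv ≫ (α_ dX.dual (M.X ≫ Y) dY.dual).inv) := by
      simp only [evalAct, dagger_comp, dagger_whiskerLeft₂, dagger_associator_inv,
        DaggerBicategory.dagger_associator]
    rw [h]
    dsimp only [evalAct]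
    bicategory
  obtain ⟨k, hk⟩ := hs
  calc _ = k ≫ (evalAct dX dY M ≫ dagger M.act) ≫ M.act := by
        rw [hact, Category.assoc, reassoc_of% hk]
    _ = k ≫ dagger (dX.sandwichAct dY _) ≫ dX.sandwichAct dY _ ≫ evalAct dX dY M := by
        rw [← hd, Category.assoc, hσ]
    _ = _ := by rw [reassoc_of% dX.dagger_sandwichAct_sandwichAct dY, hk]

theorem exists_sandwich_isomorphic (hB : SplitDaggerIdempotents B) (dX : SpecialRightDual X)
    (dY : SpecialRightDual Y) (M : DaggerBimodule dX.frobeniusMonoid dY.frobeniusMonoid) :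
    ∃ E : s ⟶ t, (dX.sandwich dY E).Isomorphic M := by
  let K : s ⟶ t := dX.dual ≫ M.X ≫ Y
  let σ : X ≫ K ≫ dY.dual ⟶ M.X := evalAct dX dY M
  have hσ : (X ≫ dX.dual) ◁ (σ ▷ (Y ≫ dY.dual)) ≫ M.act = dX.sandwichAct dY K ≫ σ :=
    dX.evalAct_naturality dY M
  have hσ' : (X ≫ dX.dual) ◁ (dagger σ ▷ (Y ≫ dY.dual)) ≫ dX.sandwichAct dY K =
      M.act ≫ dagger σ :=
    DaggerBimodule.act_naturality_dagger (M := dX.sandwich dY K) (N := M) (f := σ) hσ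
  -- Both `σ` and `σ†` are bimodule maps, so fullness descends the projection `σ† ∘ σ` to `K`.
  obtain ⟨p, hp⟩ : ∃ p : K ⟶ K, σ ≫ dagger σ = X ◁ (p ▷ dY.dual) := by
    apply dX.exists_eq_whisker dY
    calc _ = (X ≫ dX.dual) ◁ (σ ▷ (Y ≫ dY.dual)) ≫ (X ≫ dX.dual) ◁ (dagger σ ▷ (Y ≫ dY.dual)) ≫
          dX.sandwichAct dY K := by simp only [comp_whiskerRight, whiskerLeft_comp, Category.assoc]
      _ = _ := by rw [hσ', reassoc_of% hσ]
  have hσσ : dagger σ ≫ σ = 𝟙 M.X := dX.dagger_evalAct_evalAct dY M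
  have hpd : IsDaggerIdempotent p := by
    constructor
    · apply dX.whiskerLeft_whiskerRight_injective dY
      rw [← dagger_whiskerRight₂, ← dagger_whiskerLeft₂, ← hp, dagger_comp, dagger_dagger]
    · apply dX.whiskerLeft_whiskerRight_injective dY
      rw [comp_whiskerRight, whiskerLeft_comp, ← hp, Category.assoc, reassoc_of% hσσ]
  obtain ⟨E, e, he, rfl⟩ := hB s t K p hpd
  have he' : e ≫ dagger e = 𝟙 E := he
  -- `X ⊗ e ⊗ Y*` and `σ†` are isometries with the same range projection, so comparing them gives a
  -- unitary.
  have hu : IsUnitary (X ◁ (e ▷ dY.dual) ≫ σ) := by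
    constructor
    · rw [dagger_comp, Category.assoc, reassoc_of% hp, dagger_whiskerLeft₂, dagger_whiskerRight₂,
        ← whiskerLeft_comp, ← whiskerLeft_comp, ← comp_whiskerRight, ← comp_whiskerRight]
      simp [he']
    · rw [dagger_comp, Category.assoc, dagger_whiskerLeft₂, dagger_whiskerRight₂,
        ← whiskerLeft_comp_assoc, ← comp_whiskerRight, ← hp, Category.assoc, hσσ, Category.comp_id,
        hσσ]
  refine ⟨E, X ◁ (e ▷ dY.dual) ≫ σ, hu, ?_⟩
  change (X ≫ dX.dual) ◁ ((X ◁ (e ▷ dY.dual) ≫ σ) ▷ (Y ≫ dY.dual)) ≫ M.act =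
    dX.sandwichAct dY E ≫ X ◁ (e ▷ dY.dual) ≫ σ
  rw [comp_whiskerRight, whiskerLeft_comp, Category.assoc, hσ,
    reassoc_of% dX.sandwichAct_naturality dY e]

end SpecialRightDual

/-! ### The equivalence. -/

theorem moritaEquivalent_iff_daggerEquivalent (hB : SplitDaggerIdempotents B) {r s t : B}
    {X : r ⟶ s} {Y : r ⟶ t} (dX : SpecialRightDual X) (dY : SpecialRightDual Y) :
    MoritaEquivalent dX.frobeniusMonoid dY.frobeniusMonoid ↔ DaggerEquivalent s t := by
  constructor
  · rintro ⟨M, N, ⟨T, i, hi, hT⟩, ⟨T', i', hi', hT'⟩⟩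
    obtain ⟨E, hE⟩ := dX.exists_sandwich_isomorphic hB dY M
    obtain ⟨E', hE'⟩ := dY.exists_sandwich_isomorphic hB dX N
    obtain ⟨c, hc⟩ := dX.exists_isUnitary_of_sandwich_isomorphic dX
      ((((dX.isRelativeTensorProduct_sandwich dY dX E E').isomorphic hi hE hE').trans hT).trans
        dX.trivialBimodule_isomorphic_sandwich)
    obtain ⟨c', hc'⟩ := dY.exists_isUnitary_of_sandwich_isomorphic dY
      ((((dY.isRelativeTensorProduct_sandwich dX dY E' E).isomorphic hi' hE' hE).trans hT').trans
        dY.trivialBimodule_isomorphic_sandwich)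
    -- `c'` runs from `E' ⊗ E` to the identity, whereas the unit of a dagger equivalence runs the
    -- other way.
    exact ⟨E, E', dagger c', c, hc'.dagger, hc⟩
  · rintro ⟨E, E', c', c, hc', hc⟩
    exact ⟨dX.sandwich dY E, dY.sandwich dX E',
      ⟨_, _, dX.isRelativeTensorProduct_sandwich dY dX E E',
        (dX.sandwich_isomorphic dX hc).trans dX.trivialBimodule_isomorphic_sandwich.symm⟩,
      ⟨_, _, dY.isRelativeTensorProduct_sandwich dX dY E' E,
        (dY.sandwich_isomorphic dY hc'.dagger).trans
          dY.trivialBimodule_isomorphic_sandwich.symm⟩⟩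

end Bicategories

end DaggerTwoCat

theorem mainTheorem7 {B : Type u} [CategoryTheory.Bicategory.{w, v} B]
    [DaggerTwoCat.DaggerBicategory B] (hB : DaggerTwoCat.SplitDaggerIdempotents B)
    {r s t : B} (X : r ⟶ s) (Y : r ⟶ t)
    (dX : DaggerTwoCat.SpecialRightDual X) (dY : DaggerTwoCat.SpecialRightDual Y) :
    DaggerTwoCat.MoritaEquivalent dX.frobeniusMonoid dY.frobeniusMonoid ↔
      DaggerTwoCat.DaggerEquivalent s t :=
  DaggerTwoCat.moritaEquivalent_iff_daggerEquivalent hB dX dY
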